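/- Let $(N,h,J)$ be an almost Hermitian manifold, i.e. a finite-dimensional smooth manifold $N$ (without boundary) with a smooth Riemannian metric $h$ and a smooth almost complex structure $J$ such that $h(JX,JY)=h(X,Y)$. Let $\nabla$ be the Levi-Civita connection of $h$, and let $\nabla^c$ be the Chern connection of $(N,h,J)$, which is given by $$h(\nabla^c_XY,Z)=h(\nabla_XY,Z)+\tfrac12 h((\nabla_XJ)(JY),Z)+\tfrac14 h\big((\nabla_ZJ)(JY)-(\nabla_YJ)(JZ)-(\nabla_{JZ}J)(Y)+(\nabla_{JY}J)(Z),\,X\big).$$ For a connection $D$ on $TN$ put $R^D(X,Y)Z=D_{[X,Y]}Z-(D_XD_YZ-D_YD_XZ)$. The holomorphic bisectional curvature $H$ and the Hermitian bisectional curvature $H^c$ of $(N,h,J)$ are $$H(X,Y)=h(R^{\nabla}(X,JX)Y,JY),\qquad H^c(X,Y)=h(R^{\nabla^c}(X,JX)Y,JY)$$ for unit tangent vectors $X,Y$ at the same point. The manifold is Kähler if $J$ is integrable (its Nijenhuis tensor vanishes) and the Kähler form $\Omega(X,Y)=h(JX,Y)$ is closed. Let $\varepsilon\in\{1,-1\}$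 and suppose that $$(\nabla_XJ)(X)=\varepsilon\,(\nabla_{JX}J)(JX)\qquad\text{for all tangent vectors } X.$$ Then $H(X,Y)=H^c(X,Y)$ for all $p\in N$ and all unit vectors $X,Y\in T_pN$ if and only if $(N,h,J)$ is a Kähler manifold. -/

import Mathlib

open Bundle FiberBundle VectorField
open scoped Manifold ContDiff

noncomputable section

namespace AlmostHermitian

section

variable {E : Type*} [NormedAddCommGroup E] [NormedSpace ℝ E]
  {M : Type*} [TopologicalSpace M] [ChartedSpace E M] [IsManifold 𝓘(ℝ, E) ∞ M]
  [RiemannianBundle (fun x : M ↦ TangentSpace 𝓘(ℝ, E) x)]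
  [IsContMDiffRiemannianBundle 𝓘(ℝ, E) ∞ E (fun x : M ↦ TangentSpace 𝓘(ℝ, E) x)]

/-! ### The Levi-Civita connection -/

/-- The right-hand side of the Koszul formula
`2 g(∇_X Y, Z) = X g(Y,Z) + Y g(X,Z) - Z g(X,Y) + g([X,Y],Z) - g([X,Z],Y) - g([Y,Z],X)`
at the point `x`. -/
def koszul (X Y Z : Π x : M, TangentSpace 𝓘(ℝ, E) x) (x : M) : ℝ :=
  d% (fun y ↦ inner ℝ (Y y) (Z y)) x (X x)
    + d% (fun y ↦ inner ℝ (X y) (Z y)) x (Y x)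
    - d% (fun y ↦ inner ℝ (X y) (Y y)) x (Z x)
    + inner ℝ (mlieBracket 𝓘(ℝ, E) X Y x) (Z x)
    - inner ℝ (mlieBracket 𝓘(ℝ, E) X Z x) (Y x)
    - inner ℝ (mlieBracket 𝓘(ℝ, E) Y Z x) (X x)

/-- The function `g(X, Y)` is differentiable at a point where the vector fields `X`, `Y` are. -/
theorem mdifferentiableAt_inner {X Y : Π x : M, TangentSpace 𝓘(ℝ, E) x} {x : M}
    (hX : MDiffAt (T% X) x) (hY : MDiffAt (T% Y) x) :
    MDiffAt (fun y ↦ (inner ℝ (X y) (Y y) : ℝ)) x :=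
  MDifferentiableAt.inner_bundle (IB := 𝓘(ℝ, E)) (F := E)
    (E := fun x : M ↦ TangentSpace 𝓘(ℝ, E) x) (b := fun y : M ↦ y) hX hY

variable [FiniteDimensional ℝ E]

theorem koszul_tensorialAt_left {Y Z : Π x : M, TangentSpace 𝓘(ℝ, E) x} {x : M}
    (hY : MDiffAt (T% Y) x) (hZ : MDiffAt (T% Z) x) :
    TensorialAt 𝓘(ℝ, E) E (fun X ↦ koszul X Y Z x) x where
  smul {f X} hf hX := by
    have h1 := mvfderiv_fun_mul hf (mdifferentiableAt_inner hX hZ)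
    have h2 := mvfderiv_fun_mul hf (mdifferentiableAt_inner hX hY)
    simp [koszul, inner_smul_left, inner_add_left, inner_smul_right, h1, h2,
      mlieBracket_smul_left hf hX]
    ring
  add {X X'} hX hX' := by
    have h1 := mvfderiv_fun_add (mdifferentiableAt_inner hX hZ) (mdifferentiableAt_inner hX' hZ)
    have h2 := mvfderiv_fun_add (mdifferentiableAt_inner hX hY) (mdifferentiableAt_inner hX' hY)
    simp [koszul, inner_add_left, inner_add_right, h1, h2, mlieBracket_add_left hX hX']
    ring

theorem koszul_tensorialAt_right {X Y : Π x : M, TangentSpace 𝓘(ℝ, E) x} {x : M}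
    (hX : MDiffAt (T% X) x) (hY : MDiffAt (T% Y) x) :
    TensorialAt 𝓘(ℝ, E) E (fun Z ↦ koszul X Y Z x) x where
  smul {f Z} hf hZ := by
    have h1 := mvfderiv_fun_mul hf (mdifferentiableAt_inner hX hZ)
    have h2 := mvfderiv_fun_mul hf (mdifferentiableAt_inner hY hZ)
    simp [koszul, inner_smul_left, inner_add_left, inner_smul_right, h1, h2,
      mlieBracket_smul_right hf hZ, real_inner_comm]
    ring
  add {Z Z'} hZ hZ' := by
    have h1 := mvfderiv_fun_add (mdifferentiableAt_inner hX hZ) (mdifferentiableAt_inner hX hZ')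
    have h2 := mvfderiv_fun_add (mdifferentiableAt_inner hY hZ) (mdifferentiableAt_inner hY hZ')
    simp [koszul, inner_add_left, inner_add_right, h1, h2, mlieBracket_add_right hZ hZ']
    ring

/-- For a vector field `Y` differentiable at `x`, the bilinear form on `T_x M` that sends the values
`X x`, `Z x` to half of the Koszul expression of `X, Y, Z`. -/
def koszulForm (Y : Π x : M, TangentSpace 𝓘(ℝ, E) x) (x : M) (hY : MDiffAt (T% Y) x) :
    TangentSpace 𝓘(ℝ, E) x →L[ℝ] TangentSpace 𝓘(ℝ, E) x →L[ℝ] ℝ :=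
  (2⁻¹ : ℝ) • TensorialAt.mkHom₂ (I := 𝓘(ℝ, E)) (F := E) (F' := E)
    (fun X Z ↦ koszul X Y Z x) x
    (fun _ hZ ↦ koszul_tensorialAt_left hY hZ) (fun _ hX ↦ koszul_tensorialAt_right hX hY)

theorem koszulForm_apply {X Y Z : Π x : M, TangentSpace 𝓘(ℝ, E) x} {x : M}
    (hX : MDiffAt (T% X) x) (hY : MDiffAt (T% Y) x) (hZ : MDiffAt (T% Z) x) :
    koszulForm Y x hY (X x) (Z x) = 2⁻¹ * koszul X Y Z x := by
  simp [koszulForm, TensorialAt.mkHom₂_apply _ _ hX hZ]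

instance instFiniteDimensionalTangentSpace (x : M) :
    FiniteDimensional ℝ (TangentSpace 𝓘(ℝ, E) x) :=
  inferInstanceAs (FiniteDimensional ℝ E)

instance instCompleteSpaceTangentSpace (x : M) : CompleteSpace (TangentSpace 𝓘(ℝ, E) x) :=
  FiniteDimensional.complete ℝ _

open Classical in
/-- The endomorphism `X ↦ ∇_X Y` of `T_x M`, where `g(∇_X Y, Z)` is given by the Koszul formula
(and `0` if `Y` is not differentiable at `x`). -/
def leviCivitaFun (Y : Π x : M, TangentSpace 𝓘(ℝ, E) x) (x : M) :
    TangentSpace 𝓘(ℝ, E) x →L[ℝ] TangentSpace 𝓘(ℝ, E) x :=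
  if hY : MDiffAt (T% Y) x then
    InnerProductSpace.continuousLinearMapOfBilin (𝕜 := ℝ) (koszulForm Y x hY)
  else 0

theorem inner_leviCivitaFun {X Y Z : Π x : M, TangentSpace 𝓘(ℝ, E) x} {x : M}
    (hX : MDiffAt (T% X) x) (hY : MDiffAt (T% Y) x) (hZ : MDiffAt (T% Z) x) :
    (inner ℝ (leviCivitaFun Y x (X x)) (Z x) : ℝ) = 2⁻¹ * koszul X Y Z x := by
  rw [leviCivitaFun, dif_pos hY, ← koszulForm_apply hX hY hZ]
  exact InnerProductSpace.continuousLinearMapOfBilin_apply (𝕜 := ℝ) (koszulForm Y x hY) _ _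

/-- The Levi-Civita connection `∇` of the Riemannian metric of `M`, given by the Koszul formula. As
for every `CovariantDerivative`, `leviCivita Y x (X x)` is `(∇_X Y)(x)`. -/
def leviCivita : CovariantDerivative 𝓘(ℝ, E) E (fun x : M ↦ TangentSpace 𝓘(ℝ, E) x) where
  toFun := leviCivitaFun
  isCovariantDerivativeOnUniv :=
    { add := by
        intro Y Y' x hY hY' _
        have hs : MDiffAt (T% (Y + Y')) x := mdifferentiableAt_add_section hY hY'
        ext v
        refine ext_inner_right ℝ fun w ↦ ?_
        have hv := mdifferentiableAt_extend (V := fun x : M ↦ TangentSpace 𝓘(ℝ, E) x) 𝓘(ℝ, E) E v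
        have hw := mdifferentiableAt_extend (V := fun x : M ↦ TangentSpace 𝓘(ℝ, E) x) 𝓘(ℝ, E) E w
        have h1 := mvfderiv_fun_add (mdifferentiableAt_inner hY hw) (mdifferentiableAt_inner hY' hw)
        have h2 := mvfderiv_fun_add (mdifferentiableAt_inner hv hY) (mdifferentiableAt_inner hv hY')
        have e := inner_leviCivitaFun hv hs hw
        have e1 := inner_leviCivitaFun hv hY hw
        have e2 := inner_leviCivitaFun hv hY' hw
        simp only [extend_apply_self] at e e1 e2
        simp only [add_apply, inner_add_left, e, e1, e2]
        simp [koszul, inner_add_left, inner_add_right, h1, h2, mlieBracket_add_left hY hY',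
          mlieBracket_add_right hY hY']
        ring
      leibniz := by
        intro Y f x hY hf _
        have hs : MDiffAt (T% (f • Y)) x := hf.smul_section hY
        ext v
        refine ext_inner_right ℝ fun w ↦ ?_
        have hv := mdifferentiableAt_extend (V := fun x : M ↦ TangentSpace 𝓘(ℝ, E) x) 𝓘(ℝ, E) E v
        have hw := mdifferentiableAt_extend (V := fun x : M ↦ TangentSpace 𝓘(ℝ, E) x) 𝓘(ℝ, E) E w
        have h1 := mvfderiv_fun_mul hf (mdifferentiableAt_inner hY hw)
        have h2 := mvfderiv_fun_mul hf (mdifferentiableAt_inner hv hY)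
        have e := inner_leviCivitaFun hv hs hw
        have e1 := inner_leviCivitaFun hv hY hw
        simp only [extend_apply_self] at e e1
        simp only [add_apply, smul_apply, ContinuousLinearMap.smulRight_apply, inner_add_left, inner_smul_left, e, e1]
        simp [koszul, inner_smul_left, inner_smul_right, inner_add_left, h1, h2,
          mlieBracket_smul_left hf hY, mlieBracket_smul_right hf hY]
        rw [real_inner_comm (Y x) v]
        ring }

/-- The Levi-Civita connection is metric: `X g(Y, Z) = g(∇_X Y, Z) + g(Y, ∇_X Z)`. -/
theorem leviCivita_metric {X Y Z : Π x : M, TangentSpace 𝓘(ℝ, E) x} {x : M}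
    (hX : MDiffAt (T% X) x) (hY : MDiffAt (T% Y) x) (hZ : MDiffAt (T% Z) x) :
    d% (fun y ↦ (inner ℝ (Y y) (Z y) : ℝ)) x (X x) =
      inner ℝ (leviCivita Y x (X x)) (Z x) + inner ℝ (Y x) (leviCivita Z x (X x)) := by
  have e1 := inner_leviCivitaFun hX hY hZ
  have e2 := inner_leviCivitaFun hX hZ hY
  have h3 : (inner ℝ (Y x) (leviCivitaFun Z x (X x)) : ℝ) = _ := (real_inner_comm _ _).trans e2
  change _ = (inner ℝ (leviCivitaFun Y x (X x)) (Z x) : ℝ) + inner ℝ (Y x) (leviCivitaFun Z x (X x))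
  rw [e1, h3]
  have h4 := mlieBracket_swap_apply (I := 𝓘(ℝ, E)) (V := Z) (W := Y) (x := x)
  have h5 : (fun y ↦ inner ℝ (Z y) (Y y) : M → ℝ) = fun y ↦ inner ℝ (Y y) (Z y) :=
    funext fun y ↦ real_inner_comm _ _
  simp only [koszul, h4, h5, inner_neg_left]
  ring

/-- The Levi-Civita connection is torsion-free. -/
theorem leviCivita_torsion : (leviCivita (E := E) (M := M)).torsion = 0 := by
  rw [CovariantDerivative.torsion_eq_zero_iff]
  intro X Y x hX hY
  refine ext_inner_right ℝ fun w ↦ ?_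
  have hw := mdifferentiableAt_extend (V := fun x : M ↦ TangentSpace 𝓘(ℝ, E) x) 𝓘(ℝ, E) E w
  have e1 := inner_leviCivitaFun hX hY hw
  have e2 := inner_leviCivitaFun hY hX hw
  simp only [extend_apply_self] at e1 e2
  change (inner ℝ (leviCivitaFun Y x (X x) - leviCivitaFun X x (Y x)) w : ℝ) = _
  rw [inner_sub_left, e1, e2]
  have h4 := mlieBracket_swap_apply (I := 𝓘(ℝ, E)) (V := Y) (W := X) (x := x)
  have h5 : (fun y ↦ inner ℝ (Y y) (X y) : M → ℝ) = fun y ↦ inner ℝ (X y) (Y y) :=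
    funext fun y ↦ real_inner_comm _ _
  simp only [koszul, h4, h5, inner_neg_left, extend_apply_self]
  ring

/-! ### Almost Hermitian structures -/

/-- `J` is an almost complex structure on the Riemannian manifold `M` that is smooth and orthogonal
with respect to the metric, so that `M` with its metric and `J` is an almost Hermitian manifold. -/
structure IsAlmostHermitian
    (J : Π x : M, TangentSpace 𝓘(ℝ, E) x →L[ℝ] TangentSpace 𝓘(ℝ, E) x) : Prop where
  contMDiff : ContMDiff 𝓘(ℝ, E) (𝓘(ℝ, E).prod 𝓘(ℝ, E →L[ℝ] E)) ∞
    (fun x ↦ TotalSpace.mk' (E →L[ℝ] E)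
      (E := fun x : M ↦ TangentSpace 𝓘(ℝ, E) x →L[ℝ] TangentSpace 𝓘(ℝ, E) x) x (J x))
  apply_apply (x : M) (v : TangentSpace 𝓘(ℝ, E) x) : J x (J x v) = -v
  inner_apply (x : M) (v w : TangentSpace 𝓘(ℝ, E) x) :
    (inner ℝ (J x v) (J x w) : ℝ) = inner ℝ v w

variable {J : Π x : M, TangentSpace 𝓘(ℝ, E) x →L[ℝ] TangentSpace 𝓘(ℝ, E) x}

theorem IsAlmostHermitian.mdifferentiableAt_apply (hJ : IsAlmostHermitian J)
    {Y : Π x : M, TangentSpace 𝓘(ℝ, E) x} {x : M} (hY : MDiffAt (T% Y) x) :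
    MDiffAt (T% (fun y ↦ J y (Y y))) x :=
  MDifferentiableAt.clm_bundle_apply (F₁ := E) (F₂ := E)
    (E₁ := fun x : M ↦ TangentSpace 𝓘(ℝ, E) x) (E₂ := fun x : M ↦ TangentSpace 𝓘(ℝ, E) x)
    (b := fun y : M ↦ y)
    (hJ.contMDiff.mdifferentiable (by simp) x) hY

/-- For a vector field `Y`, the endomorphism `X ↦ (∇_X J) Y = ∇_X (J Y) - J (∇_X Y)` of `T_x M`. -/
def nablaJAux (J : Π x : M, TangentSpace 𝓘(ℝ, E) x →L[ℝ] TangentSpace 𝓘(ℝ, E) x)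
    (Y : Π x : M, TangentSpace 𝓘(ℝ, E) x) (x : M) :
    TangentSpace 𝓘(ℝ, E) x →L[ℝ] TangentSpace 𝓘(ℝ, E) x :=
  leviCivita (fun y ↦ J y (Y y)) x - J x ∘L leviCivita Y x

theorem nablaJAux_tensorialAt (hJ : IsAlmostHermitian J) (x : M) :
    TensorialAt 𝓘(ℝ, E) E (fun Y ↦ nablaJAux J Y x) x where
  smul {f Y} hf hY := by
    have h : (fun y ↦ J y ((f • Y) y)) = f • fun y ↦ J y (Y y) := by ext y; simp
    have e1 := leviCivita.isCovariantDerivativeOnUniv.leibniz hY hf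
    have e2 := leviCivita.isCovariantDerivativeOnUniv.leibniz (hJ.mdifferentiableAt_apply hY) hf
    simp only [nablaJAux, h, e1, e2]
    ext v
    simp
    module
  add {Y Y'} hY hY' := by
    have h : (fun y ↦ J y ((Y + Y') y)) = (fun y ↦ J y (Y y)) + fun y ↦ J y (Y' y) := by
      ext y; simp
    have e1 := leviCivita.isCovariantDerivativeOnUniv.add hY hY'
    have e2 := leviCivita.isCovariantDerivativeOnUniv.add (hJ.mdifferentiableAt_apply hY)
      (hJ.mdifferentiableAt_apply hY')
    simp only [nablaJAux, h, e1, e2]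
    ext v
    simp
    module

/-- The covariant derivative `∇J` of the almost complex structure with respect to the Levi-Civita
connection: `nablaJ hJ x Y X` is `(∇_X J) Y`, for `X, Y` in `T_x M` (in this order of the
arguments). -/
def nablaJ (hJ : IsAlmostHermitian J) (x : M) :
    TangentSpace 𝓘(ℝ, E) x →L[ℝ] TangentSpace 𝓘(ℝ, E) x →L[ℝ] TangentSpace 𝓘(ℝ, E) x :=
  TensorialAt.mkHom (I := 𝓘(ℝ, E)) (F := E) (fun Y ↦ nablaJAux J Y x) x (nablaJAux_tensorialAt hJ x)

theorem nablaJ_apply (hJ : IsAlmostHermitian J) {x : M} {Y : Π x : M, TangentSpace 𝓘(ℝ, E) x}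
    (hY : MDiffAt (T% Y) x) (v : TangentSpace 𝓘(ℝ, E) x) :
    nablaJ hJ x (Y x) v = leviCivita (fun y ↦ J y (Y y)) x v - J x (leviCivita Y x v) := by
  rw [nablaJ, TensorialAt.mkHom_apply _ hY]
  rfl

/-! ### The Chern connection -/

/-- The trilinear form
`g((∇_Z J)(JY) - (∇_Y J)(JZ) - (∇_{JZ} J)(Y) + (∇_{JY} J)(Z), X)` on `T_x M`. -/
def chernForm (hJ : IsAlmostHermitian J) (x : M) (X Y Z : TangentSpace 𝓘(ℝ, E) x) : ℝ :=
  inner ℝ (nablaJ hJ x (J x Y) Z - nablaJ hJ x (J x Z) Y - nablaJ hJ x Y (J x Z)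
    + nablaJ hJ x Z (J x Y)) X

/-- For `Y` in `T_x M`, the form `chernForm` as a bilinear form in `X` and `Z`. -/
def chernBilin (hJ : IsAlmostHermitian J) (x : M) (Y : TangentSpace 𝓘(ℝ, E) x) :
    TangentSpace 𝓘(ℝ, E) x →L[ℝ] TangentSpace 𝓘(ℝ, E) x →L[ℝ] ℝ :=
  (LinearMap.mk₂ ℝ (fun X Z ↦ chernForm hJ x X Y Z)
    (fun X X' Z ↦ by simp [chernForm, inner_add_right])
    (fun c X Z ↦ by simp [chernForm, inner_smul_right])
    (fun X Z Z' ↦ by simp [chernForm, inner_add_left, inner_sub_left]; ring)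
    (fun c X Z ↦ by
      simp [chernForm, inner_add_left, inner_sub_left, inner_smul_left]; ring)).toContinuousBilinearMap

theorem inner_chernBilin (hJ : IsAlmostHermitian J) (x : M)
    (X Y Z : TangentSpace 𝓘(ℝ, E) x) :
    (inner ℝ (InnerProductSpace.continuousLinearMapOfBilin (𝕜 := ℝ) (chernBilin hJ x Y) X) Z : ℝ) =
      chernForm hJ x X Y Z :=
  InnerProductSpace.continuousLinearMapOfBilin_apply (𝕜 := ℝ) (chernBilin hJ x Y) X Z

/-- The difference `∇^c - ∇` of the Chern and the Levi-Civita connection: `chernDiff hJ x Y X` is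
the value of `∇^c_X Y - ∇_X Y` at `x`. -/
def chernDiff (hJ : IsAlmostHermitian J) (x : M) :
    TangentSpace 𝓘(ℝ, E) x →L[ℝ] TangentSpace 𝓘(ℝ, E) x →L[ℝ] TangentSpace 𝓘(ℝ, E) x :=
  LinearMap.toContinuousLinearMap
    { toFun Y := (2⁻¹ : ℝ) • nablaJ hJ x (J x Y)
        + (4⁻¹ : ℝ) • InnerProductSpace.continuousLinearMapOfBilin (𝕜 := ℝ) (chernBilin hJ x Y)
      map_add' Y Y' := by
        ext X
        refine ext_inner_right ℝ fun Z ↦ ?_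
        simp only [add_apply, smul_apply, inner_add_left, inner_smul_left, inner_chernBilin]
        simp [chernForm, inner_add_left, inner_sub_left]
        ring
      map_smul' c Y := by
        ext X
        refine ext_inner_right ℝ fun Z ↦ ?_
        simp only [add_apply, smul_apply, inner_add_left, inner_smul_left, inner_chernBilin]
        simp [chernForm, inner_add_left, inner_sub_left, inner_smul_left]
        ring }

/-- The Chern connection `∇^c` of an almost Hermitian manifold. -/
def chern (hJ : IsAlmostHermitian J) :
    CovariantDerivative 𝓘(ℝ, E) E (fun x : M ↦ TangentSpace 𝓘(ℝ, E) x) :=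
  leviCivita.addOneForm (chernDiff hJ)

/-- The formula that defines the Chern connection:
`g(∇^c_X Y, Z) = g(∇_X Y, Z) + 1/2 g((∇_X J)(JY), Z)
+ 1/4 g((∇_Z J)(JY) - (∇_Y J)(JZ) - (∇_{JZ} J)(Y) + (∇_{JY} J)(Z), X)`. -/
theorem inner_chern (hJ : IsAlmostHermitian J) (Y : Π x : M, TangentSpace 𝓘(ℝ, E) x) (x : M)
    (X Z : TangentSpace 𝓘(ℝ, E) x) :
    (inner ℝ (chern hJ Y x X) Z : ℝ) = inner ℝ (leviCivita Y x X) Z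
      + 1 / 2 * inner ℝ (nablaJ hJ x (J x (Y x)) X) Z
      + 1 / 4 * inner ℝ (nablaJ hJ x (J x (Y x)) Z - nablaJ hJ x (J x Z) (Y x)
          - nablaJ hJ x (Y x) (J x Z) + nablaJ hJ x Z (J x (Y x))) X := by
  have h : chern hJ Y x X = leviCivita Y x X + ((2⁻¹ : ℝ) • nablaJ hJ x (J x (Y x)) X + (4⁻¹ : ℝ) •
      InnerProductSpace.continuousLinearMapOfBilin (𝕜 := ℝ) (chernBilin hJ x (Y x)) X) := rfl
  rw [h]
  simp only [inner_add_left, inner_smul_left, inner_chernBilin, chernForm]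
  simp
  ring

/-! ### Curvature -/

/-- The curvature `R(X, Y) Z = ∇_{[X,Y]} Z - (∇_X ∇_Y Z - ∇_Y ∇_X Z)` of a connection `∇` on the
tangent bundle, for vector fields `X`, `Y`, `Z`. With this sign, `g(R(X, Y) X, Y)` is the sectional
curvature of the plane with orthonormal basis `X, Y` if `∇` is the Levi-Civita connection. -/
def curvature (cov : CovariantDerivative 𝓘(ℝ, E) E (fun x : M ↦ TangentSpace 𝓘(ℝ, E) x))
    (X Y Z : Π x : M, TangentSpace 𝓘(ℝ, E) x) (x : M) : TangentSpace 𝓘(ℝ, E) x :=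
  cov Z x (mlieBracket 𝓘(ℝ, E) X Y x)
    - (cov (fun y ↦ cov Z y (Y y)) x (X x) - cov (fun y ↦ cov Z y (X y)) x (Y x))

/-- The curvature tensor `R(u, v) w` of a connection at `x`, for tangent vectors `u, v, w` at `x`:
these are extended to the vector fields that are constant in the preferred trivialization of the
tangent bundle at `x`. The curvature of a smooth connection is tensorial, so other smooth extensions
give the same value. -/
def curvatureAt (cov : CovariantDerivative 𝓘(ℝ, E) E (fun x : M ↦ TangentSpace 𝓘(ℝ, E) x))
    (x : M) (u v w : TangentSpace 𝓘(ℝ, E) x) : TangentSpace 𝓘(ℝ, E) x :=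
  curvature cov (extend E u) (extend E v) (extend E w) x

/-- The holomorphic bisectional curvature `g(R(u, Ju) v, Jv)`, for unit tangent vectors `u, v`, of
a connection on the tangent bundle. -/
def bisectionalCurvature (J : Π x : M, TangentSpace 𝓘(ℝ, E) x →L[ℝ] TangentSpace 𝓘(ℝ, E) x)
    (cov : CovariantDerivative 𝓘(ℝ, E) E (fun x : M ↦ TangentSpace 𝓘(ℝ, E) x))
    (x : M) (u v : TangentSpace 𝓘(ℝ, E) x) : ℝ :=
  inner ℝ (curvatureAt cov x u (J x u) v) (J x v)

/-- The holomorphic bisectional curvature of the manifold: that of its Levi-Civita connection. -/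
def holomorphicBisectionalCurvature
    (J : Π x : M, TangentSpace 𝓘(ℝ, E) x →L[ℝ] TangentSpace 𝓘(ℝ, E) x)
    (x : M) (u v : TangentSpace 𝓘(ℝ, E) x) : ℝ :=
  bisectionalCurvature J leviCivita x u v

/-- The Hermitian bisectional curvature: the holomorphic bisectional curvature of the Chern
connection. -/
def hermitianBisectionalCurvature (hJ : IsAlmostHermitian J)
    (x : M) (u v : TangentSpace 𝓘(ℝ, E) x) : ℝ :=
  bisectionalCurvature J (chern hJ) x u v

/-! ### Kähler manifolds -/

/-- The Kähler form `Ω(X, Y) = g(JX, Y)` on vector fields. -/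
def kahlerForm (J : Π x : M, TangentSpace 𝓘(ℝ, E) x →L[ℝ] TangentSpace 𝓘(ℝ, E) x)
    (X Y : Π x : M, TangentSpace 𝓘(ℝ, E) x) (x : M) : ℝ :=
  inner ℝ (J x (X x)) (Y x)

/-- The exterior derivative `dΩ` of the Kähler form on vector fields, by the invariant formula
`dΩ(X,Y,Z) = X Ω(Y,Z) + Y Ω(Z,X) + Z Ω(X,Y) - Ω([X,Y],Z) - Ω([Y,Z],X) - Ω([Z,X],Y)`. -/
def dKahlerForm (J : Π x : M, TangentSpace 𝓘(ℝ, E) x →L[ℝ] TangentSpace 𝓘(ℝ, E) x)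
    (X Y Z : Π x : M, TangentSpace 𝓘(ℝ, E) x) (x : M) : ℝ :=
  d% (kahlerForm J Y Z) x (X x) + d% (kahlerForm J Z X) x (Y x) + d% (kahlerForm J X Y) x (Z x)
    - kahlerForm J (mlieBracket 𝓘(ℝ, E) X Y) Z x
    - kahlerForm J (mlieBracket 𝓘(ℝ, E) Y Z) X x
    - kahlerForm J (mlieBracket 𝓘(ℝ, E) Z X) Y x

/-- The Nijenhuis tensor `N(X, Y) = [JX, JY] - J[JX, Y] - J[X, JY] - [X, Y]` on vector fields. -/
def nijenhuis (J : Π x : M, TangentSpace 𝓘(ℝ, E) x →L[ℝ] TangentSpace 𝓘(ℝ, E) x)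
    (X Y : Π x : M, TangentSpace 𝓘(ℝ, E) x) (x : M) : TangentSpace 𝓘(ℝ, E) x :=
  mlieBracket 𝓘(ℝ, E) (fun y ↦ J y (X y)) (fun y ↦ J y (Y y)) x
    - J x (mlieBracket 𝓘(ℝ, E) (fun y ↦ J y (X y)) Y x)
    - J x (mlieBracket 𝓘(ℝ, E) X (fun y ↦ J y (Y y)) x)
    - mlieBracket 𝓘(ℝ, E) X Y x

/-- An almost Hermitian manifold is Kähler if its almost complex structure is integrable, that is,
has vanishing Nijenhuis tensor, and its Kähler form is closed. The vector fields are only required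
to be smooth near the point considered. -/
structure IsKahler (J : Π x : M, TangentSpace 𝓘(ℝ, E) x →L[ℝ] TangentSpace 𝓘(ℝ, E) x) :
    Prop extends IsAlmostHermitian J where
  nijenhuis_eq_zero (x : M) (X Y : Π x : M, TangentSpace 𝓘(ℝ, E) x)
    (hX : CMDiffAt ∞ (T% X) x) (hY : CMDiffAt ∞ (T% Y) x) : nijenhuis J X Y x = 0
  dKahlerForm_eq_zero (x : M) (X Y Z : Π x : M, TangentSpace 𝓘(ℝ, E) x)
    (hX : CMDiffAt ∞ (T% X) x) (hY : CMDiffAt ∞ (T% Y) x) (hZ : CMDiffAt ∞ (T% Z) x) :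
    dKahlerForm J X Y Z x = 0

end

end AlmostHermitian

end

/-!
Write `∇ᶜ = ∇ + A`. Since `∇J` anticommutes with `J`, the difference tensor satisfies
`h(A_X Y, J Y) = h(S(Y, Y), X)` with `S` the symmetric tensor given by
`S(Y, Y) = ((∇_Y J) Y + (∇_{JY} J) J Y) / 2`, which vanishes exactly on quasi-Kähler manifolds.
Hence `h((R - Rᶜ)(U, V) W, J W)` is a difference of two values of `∇S` plus
`2 h(A_U W, J A_V W)`. For `W = U = X` and `V = J X` it is, up to a factor `-1/8`, the quadratic
form `‖P‖² + 6 h(P, Q) + ‖Q‖²` in `P = (∇_X J) X` and `Q = (∇_{JX} J) J X`. If `P = ε Q` with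
`ε² + 6ε + 1 ≠ 0`, equality of the curvatures thus forces `P = Q = 0`, so that `S = 0`. On a
quasi-Kähler manifold `H(X, Y) - Hᶜ(X, Y)` reduces to `‖(∇_X J) Y‖² / 2`, so that equality of the
bisectional curvatures means `∇J = 0`, which is the Kähler condition.
-/

noncomputable section

namespace AlmostHermitian

section

variable {EB : Type*} [NormedAddCommGroup EB] [NormedSpace ℝ EB]
  {HB : Type*} [TopologicalSpace HB] {IB : ModelWithCorners ℝ EB HB} {n : ℕ∞ω}
  {B : Type*} [TopologicalSpace B] [ChartedSpace HB B] {ι : Type*} [Fintype ι] [DecidableEq ι]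

theorem contMDiffAt_det {A : B → Matrix ι ι ℝ} {x : B}
    (hA : ∀ i j, CMDiffAt n (fun y ↦ A y i j) x) : CMDiffAt n (fun y ↦ (A y).det) x := by
  simp only [Matrix.det_apply']
  exact ContMDiffAt.sum fun σ _ ↦ contMDiffAt_const.mul (ContMDiffAt.prod fun i _ ↦ hA _ _)

theorem contMDiffAt_inv_mulVec {A : B → Matrix ι ι ℝ} {v : B → ι → ℝ} {x : B}
    (hA : ∀ i j, CMDiffAt n (fun y ↦ A y i j) x) (hv : ∀ j, CMDiffAt n (fun y ↦ v y j) x)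
    (hdet : (A x).det ≠ 0) (i : ι) : CMDiffAt n (fun y ↦ ((A y)⁻¹).mulVec (v y) i) x := by
  have hcramer : CMDiffAt n (fun y ↦ (A y).cramer (v y) i) x := by
    simp only [Matrix.cramer_apply]
    refine contMDiffAt_det fun j k ↦ ?_
    by_cases hk : k = i
    · simpa only [hk, Matrix.updateCol_self] using hv j
    · simpa only [Matrix.updateCol_ne hk] using hA j k
  have hinv := (contDiffAt_inv ℝ hdet).contMDiffAt.comp x (contMDiffAt_det hA)
  refine (hinv.mul hcramer).congr_of_eventuallyEq (.of_forall fun y ↦ ?_)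
  simp [Matrix.inv_def, Matrix.smul_mulVec, Matrix.cramer_eq_adjugate_mulVec]

theorem basis_repr_eq_inv_gram_mulVec {V : Type*} [NormedAddCommGroup V] [InnerProductSpace ℝ V]
    (b : Module.Basis ι ℝ V) (v : V) :
    b.repr v = ((Matrix.gram ℝ b)⁻¹).mulVec (fun j ↦ inner ℝ (b j) v) := by
  have hdet : IsUnit (Matrix.gram ℝ b).det :=
    (Matrix.det_gram_ne_zero_iff_linearIndependent.2 b.linearIndependent).isUnit
  have hgram : (fun j ↦ inner ℝ (b j) v) = (Matrix.gram ℝ b).mulVec (b.repr v) := by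
    funext j
    conv_lhs => rw [← b.sum_repr v]
    simp only [inner_sum, inner_smul_right, Matrix.mulVec, dotProduct, Matrix.gram_apply, mul_comm]
  rw [hgram, Matrix.mulVec_mulVec, Matrix.nonsing_inv_mul _ hdet, Matrix.one_mulVec]

end

section

variable {EB : Type*} [NormedAddCommGroup EB] [NormedSpace ℝ EB]
  {HB : Type*} [TopologicalSpace HB] {IB : ModelWithCorners ℝ EB HB} {n : ℕ∞ω}
  {B : Type*} [TopologicalSpace B] [ChartedSpace HB B]
  {F : Type*} [NormedAddCommGroup F] [NormedSpace ℝ F] [FiniteDimensional ℝ F]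
  {V : B → Type*} [TopologicalSpace (TotalSpace F V)] [∀ x, NormedAddCommGroup (V x)]
  [∀ x, InnerProductSpace ℝ (V x)] [FiberBundle F V] [VectorBundle ℝ F V]
  [IsContMDiffRiemannianBundle IB n F V]

theorem contMDiffAt_of_inner_localFrame {ι : Type*} {s : ι → Π x : B, V x} {u : Set B}
    (hs : IsLocalFrameOn IB F n s u) {x : B} (hu : u ∈ nhds x) {t : Π x : B, V x}
    (h : ∀ i, CMDiffAt n (fun y ↦ (inner ℝ (t y) (s i y) : ℝ)) x) : CMDiffAt n (T% t) x := by
  classical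
  have hx := mem_of_mem_nhds hu
  have := hs.fintypeOfFiniteDimensional hx
  have hframe (i) : CMDiffAt n (T% (s i)) x := (hs.contMDiffOn i).contMDiffAt hu
  have hdet : (Matrix.gram ℝ fun i ↦ s i x).det ≠ 0 :=
    Matrix.det_gram_ne_zero_iff_linearIndependent.2 (hs.linearIndependent hx)
  refine hs.contMDiffAt_of_coeff (fun i ↦ ?_) hu
  refine (contMDiffAt_inv_mulVec (A := fun y ↦ Matrix.gram ℝ fun i ↦ s i y)
    (fun i j ↦ (hframe i).inner_bundle (hframe j)) h hdet i).congr_of_eventuallyEq ?_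
  filter_upwards [hu] with y hy
  have hbasis : ⇑(hs.toBasisAt hy) = fun i ↦ s i y := funext (hs.toBasisAt_coe hy)
  simp [hs.coeff_apply_of_mem hy, basis_repr_eq_inv_gram_mulVec, hbasis, real_inner_comm]

theorem contMDiffAt_of_inner [ContMDiffVectorBundle n F V IB] {x : B} {t : Π x : B, V x}
    (h : ∀ s : Π x : B, V x, CMDiffAt n (T% s) x →
      CMDiffAt n (fun y ↦ (inner ℝ (t y) (s y) : ℝ)) x) : CMDiffAt n (T% t) x :=
  let e := trivializationAt F V x
  have hx : x ∈ e.baseSet := mem_baseSet_trivializationAt' x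
  contMDiffAt_of_inner_localFrame
    (e.isLocalFrameOn_localFrame_baseSet IB n (Module.finBasis ℝ F)) (e.open_baseSet.mem_nhds hx)
    fun i ↦ h _ (contMDiffAt_localFrame_of_mem n e _ i hx)

end

section

variable {E : Type*} [NormedAddCommGroup E] [NormedSpace ℝ E] {H : Type*} [TopologicalSpace H]
  {I : ModelWithCorners ℝ E H} {M : Type*} [TopologicalSpace M] [ChartedSpace H M]

theorem contMDiffAt_mvfderiv_apply {F : Type*} [NormedAddCommGroup F] [NormedSpace ℝ F]
    {m n : ℕ∞ω} [IsManifold I 1 M] [IsManifold I n M] {f : M → F} {V : Π x : M, TangentSpace I x}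
    {x : M} (hf : CMDiffAt n f x) (hV : CMDiffAt m (T% V) x) (hmn : m + 1 ≤ n) :
    CMDiffAt m (fun y ↦ d% f y (V y)) x := by
  have h := ContMDiffAt.clm_apply_of_inCoordinates (F₁ := E) (F₂ := F)
    (E₁ := fun x : M ↦ TangentSpace I x) (E₂ := fun x : F ↦ TangentSpace 𝓘(ℝ, F) x)
    (b₁ := fun y : M ↦ y) (b₂ := f) (ϕ := mfderiv% f) (v := V)
    (hf.mfderiv_const hmn) hV (hf.of_le (le_self_add.trans hmn))
  exact (contMDiff_snd_tangentBundle_modelSpace F 𝓘(ℝ, F)).contMDiffAt.comp x h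

theorem eventually_mdifferentiableAt [IsManifold I 1 M] {E' : Type*} [NormedAddCommGroup E']
    [NormedSpace ℝ E'] {H' : Type*} [TopologicalSpace H'] {I' : ModelWithCorners ℝ E' H'}
    {M' : Type*} [TopologicalSpace M'] [ChartedSpace H' M'] [IsManifold I' 1 M']
    {f : M → M'} {x : M} {n : ℕ∞ω} (hn : 1 ≤ n) (hf : CMDiffAt n f x) :
    ∀ᶠ y in nhds x, MDiffAt f y :=
  ((contMDiffAt_iff_contMDiffAt_nhds (by simp)).1 (hf.of_le hn)).mono
    fun _ h ↦ h.mdifferentiableAt one_ne_zero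

end

section

variable {E : Type*} [NormedAddCommGroup E] [NormedSpace ℝ E]
  {M : Type*} [TopologicalSpace M] [ChartedSpace E M] [IsManifold 𝓘(ℝ, E) ∞ M]
  {x : M} {X Y Z : Π x : M, TangentSpace 𝓘(ℝ, E) x}

/-! ### Smoothness of the Levi-Civita and Chern connections -/

theorem mdifferentiableAt_extend_vectorField (v : TangentSpace 𝓘(ℝ, E) x) :
    MDiffAt (T% (extend E v)) x :=
  mdifferentiableAt_extend (V := fun x : M ↦ TangentSpace 𝓘(ℝ, E) x) 𝓘(ℝ, E) E v

theorem contMDiffAt_extend_vectorField (v : TangentSpace 𝓘(ℝ, E) x) :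
    CMDiffAt ∞ (T% (extend E v)) x :=
  contMDiffAt_extend (V := fun x : M ↦ TangentSpace 𝓘(ℝ, E) x) 𝓘(ℝ, E) E v

variable [RiemannianBundle (fun x : M ↦ TangentSpace 𝓘(ℝ, E) x)]
  {J : Π x : M, TangentSpace 𝓘(ℝ, E) x →L[ℝ] TangentSpace 𝓘(ℝ, E) x}

theorem IsAlmostHermitian.contMDiffAt_apply (hJ : IsAlmostHermitian J)
    (hY : CMDiffAt ∞ (T% Y) x) : CMDiffAt ∞ (T% (fun y ↦ J y (Y y))) x :=
  ContMDiffAt.clm_bundle_apply (F₁ := E) (F₂ := E)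
    (E₁ := fun x : M ↦ TangentSpace 𝓘(ℝ, E) x) (E₂ := fun x : M ↦ TangentSpace 𝓘(ℝ, E) x)
    (b := fun y : M ↦ y) (hJ.contMDiff x) hY

theorem IsAlmostHermitian.inner_apply_left (hJ : IsAlmostHermitian J)
    (v w : TangentSpace 𝓘(ℝ, E) x) : (inner ℝ (J x v) w : ℝ) = -inner ℝ v (J x w) := by
  rw [← hJ.inner_apply x v (J x w), hJ.apply_apply, inner_neg_right, neg_neg]

theorem IsAlmostHermitian.ext_inner_J (hJ : IsAlmostHermitian J) {v w : TangentSpace 𝓘(ℝ, E) x}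
    (h : ∀ Z, (inner ℝ v (J x Z) : ℝ) = inner ℝ w (J x Z)) : v = w :=
  ext_inner_right ℝ fun Z ↦ by simpa [hJ.apply_apply] using h (-J x Z)

variable [IsContMDiffRiemannianBundle 𝓘(ℝ, E) ∞ E (fun x : M ↦ TangentSpace 𝓘(ℝ, E) x)]

theorem contMDiffAt_inner (hX : CMDiffAt ∞ (T% X) x) (hY : CMDiffAt ∞ (T% Y) x) :
    CMDiffAt ∞ (fun y ↦ (inner ℝ (X y) (Y y) : ℝ)) x :=
  ContMDiffAt.inner_bundle (IB := 𝓘(ℝ, E)) (F := E)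
    (E := fun x : M ↦ TangentSpace 𝓘(ℝ, E) x) (b := fun y : M ↦ y) hX hY

variable [FiniteDimensional ℝ E]

theorem contMDiffAt_koszul (hX : CMDiffAt ∞ (T% X) x) (hY : CMDiffAt ∞ (T% Y) x)
    (hZ : CMDiffAt ∞ (T% Z) x) : CMDiffAt ∞ (koszul X Y Z) x := by
  have : IsManifold 𝓘(ℝ, E) (minSmoothness ℝ 2) M := by
    simp only [minSmoothness_of_isRCLikeNormedField]; infer_instance
  have : IsManifold 𝓘(ℝ, E) (((⊤ : ℕ∞) : ℕ∞ω) + 1) M := by simpa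
  have hderiv {U V W : Π x : M, TangentSpace 𝓘(ℝ, E) x} (hU : CMDiffAt ∞ (T% U) x)
      (hV : CMDiffAt ∞ (T% V) x) (hW : CMDiffAt ∞ (T% W) x) :
      CMDiffAt ∞ (fun y ↦ d% (fun z ↦ (inner ℝ (U z) (V z) : ℝ)) y (W y)) x :=
    contMDiffAt_mvfderiv_apply (contMDiffAt_inner hU hV) hW (by simp)
  have hbracket {U V W : Π x : M, TangentSpace 𝓘(ℝ, E) x} (hU : CMDiffAt ∞ (T% U) x)
      (hV : CMDiffAt ∞ (T% V) x) (hW : CMDiffAt ∞ (T% W) x) :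
      CMDiffAt ∞ (fun y ↦ (inner ℝ (mlieBracket 𝓘(ℝ, E) U V y) (W y) : ℝ)) x :=
    contMDiffAt_inner (hU.mlieBracket_vectorField (m := ⊤) (n := ⊤) hV (by simp)) hW
  exact (((((hderiv hY hZ hX).add (hderiv hX hZ hY)).sub (hderiv hX hY hZ)).add
    (hbracket hX hY hZ)).sub (hbracket hX hZ hY)).sub (hbracket hY hZ hX)

theorem contMDiffAt_leviCivita (hX : CMDiffAt ∞ (T% X) x) (hY : CMDiffAt ∞ (T% Y) x) :
    CMDiffAt ∞ (T% (fun y ↦ leviCivita Y y (X y))) x := by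
  refine contMDiffAt_of_inner (V := fun x : M ↦ TangentSpace 𝓘(ℝ, E) x) fun Z hZ ↦ ?_
  refine (contMDiffAt_const.mul (contMDiffAt_koszul hX hY hZ)).congr_of_eventuallyEq
    (f := fun y ↦ (2⁻¹ : ℝ) * koszul X Y Z y) ?_
  filter_upwards [eventually_mdifferentiableAt (by simp) hX,
    eventually_mdifferentiableAt (by simp) hY,
    eventually_mdifferentiableAt (by simp) hZ] with y hXy hYy hZy
  exact inner_leviCivitaFun hXy hYy hZy

theorem contMDiffAt_nablaJ (hJ : IsAlmostHermitian J)
    (hX : CMDiffAt ∞ (T% X) x) (hY : CMDiffAt ∞ (T% Y) x) :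
    CMDiffAt ∞ (T% (fun y ↦ nablaJ hJ y (Y y) (X y))) x := by
  refine ((contMDiffAt_leviCivita hX (hJ.contMDiffAt_apply hY)).sub_section
    (hJ.contMDiffAt_apply (contMDiffAt_leviCivita hX hY))).congr_of_eventuallyEq ?_
  filter_upwards [eventually_mdifferentiableAt (by simp) hY] with y hYy
  exact congrArg (TotalSpace.mk' E y) (nablaJ_apply hJ hYy _)

theorem inner_chernDiff (hJ : IsAlmostHermitian J) (X Y Z : TangentSpace 𝓘(ℝ, E) x) :
    (inner ℝ (chernDiff hJ x Y X) Z : ℝ) =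
      1 / 2 * inner ℝ (nablaJ hJ x (J x Y) X) Z + 1 / 4 * chernForm hJ x X Y Z := by
  have h : chernDiff hJ x Y X = (2⁻¹ : ℝ) • nablaJ hJ x (J x Y) X + (4⁻¹ : ℝ) •
      InnerProductSpace.continuousLinearMapOfBilin (𝕜 := ℝ) (chernBilin hJ x Y) X := rfl
  rw [h, inner_add_left, real_inner_smul_left, real_inner_smul_left, inner_chernBilin]
  norm_num

theorem contMDiffAt_chernDiff (hJ : IsAlmostHermitian J)
    (hX : CMDiffAt ∞ (T% X) x) (hY : CMDiffAt ∞ (T% Y) x) :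
    CMDiffAt ∞ (T% (fun y ↦ chernDiff hJ y (Y y) (X y))) x := by
  refine contMDiffAt_of_inner (V := fun x : M ↦ TangentSpace 𝓘(ℝ, E) x) fun Z hZ ↦ ?_
  simp only [inner_chernDiff, chernForm]
  have hJY := hJ.contMDiffAt_apply hY
  have hJZ := hJ.contMDiffAt_apply hZ
  have hform := (((contMDiffAt_nablaJ hJ hZ hJY).sub_section
    (contMDiffAt_nablaJ hJ hY hJZ)).sub_section
    (contMDiffAt_nablaJ hJ hJZ hY)).add_section (contMDiffAt_nablaJ hJ hJY hZ)
  exact (contMDiffAt_const.mul (contMDiffAt_inner (contMDiffAt_nablaJ hJ hX hJY) hZ)).add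
    (contMDiffAt_const.mul (contMDiffAt_inner hform hX))

/-! ### The Levi-Civita derivative -/

theorem mvfderiv_inner (hY : MDiffAt (T% Y) x) (hZ : MDiffAt (T% Z) x)
    (u : TangentSpace 𝓘(ℝ, E) x) :
    d% (fun y ↦ (inner ℝ (Y y) (Z y) : ℝ)) x u =
      inner ℝ (leviCivita Y x u) (Z x) + inner ℝ (Y x) (leviCivita Z x u) := by
  simpa only [extend_apply_self] using
    leviCivita_metric (mdifferentiableAt_extend_vectorField u) hY hZ

theorem inner_leviCivita_add_of_orthogonal (hY : MDiffAt (T% Y) x) (hZ : MDiffAt (T% Z) x)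
    (horth : ∀ y, (inner ℝ (Y y) (Z y) : ℝ) = 0) (u : TangentSpace 𝓘(ℝ, E) x) :
    (inner ℝ (leviCivita Y x u) (Z x) + inner ℝ (Y x) (leviCivita Z x u) : ℝ) = 0 := by
  simp only [← mvfderiv_inner hY hZ, horth, mvfderiv_const, zero_apply]

theorem leviCivita_add (hY : MDiffAt (T% Y) x) (hZ : MDiffAt (T% Z) x)
    (u : TangentSpace 𝓘(ℝ, E) x) :
    leviCivita (fun y ↦ Y y + Z y) x u = leviCivita Y x u + leviCivita Z x u :=
  congrArg (fun f ↦ f u) (leviCivita.isCovariantDerivativeOnUniv.add hY hZ)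

theorem leviCivita_sub_leviCivita (hX : MDiffAt (T% X) x) (hY : MDiffAt (T% Y) x) :
    leviCivita Y x (X x) - leviCivita X x (Y x) = mlieBracket 𝓘(ℝ, E) X Y x :=
  (CovariantDerivative.torsion_eq_zero_iff _).1 leviCivita_torsion hX hY

theorem leviCivita_J (hJ : IsAlmostHermitian J) (hY : MDiffAt (T% Y) x)
    (u : TangentSpace 𝓘(ℝ, E) x) :
    leviCivita (fun y ↦ J y (Y y)) x u = nablaJ hJ x (Y x) u + J x (leviCivita Y x u) := by
  rw [nablaJ_apply hJ hY, sub_add_cancel]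

/-! ### The tensor `∇J` and the difference of the two connections -/

section

variable (hJ : IsAlmostHermitian J) (X Y Z : TangentSpace 𝓘(ℝ, E) x)

/-- The tensor `∇J` as the trilinear form `h((∇_X J) Y, Z)`. -/
def nablaForm : ℝ :=
  inner ℝ (nablaJ hJ x Y X) Z

theorem nablaJ_apply_J : nablaJ hJ x (J x Y) X = -J x (nablaJ hJ x Y X) := by
  have hY := mdifferentiableAt_extend_vectorField Y
  have hJJY : (fun y ↦ J y (J y (extend E Y y))) = (-1 : ℝ) • extend E Y := by
    ext y; simp [hJ.apply_apply]
  have hnabla := leviCivita_J hJ hY X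
  have hnablaJ := leviCivita_J hJ (hJ.mdifferentiableAt_apply hY) X
  rw [hJJY, leviCivita.isCovariantDerivativeOnUniv.smul_const (-1 : ℝ) hY, hnabla] at hnablaJ
  simp only [extend_apply_self, smul_apply, map_add, hJ.apply_apply] at hnablaJ
  linear_combination (norm := module) -hnablaJ

theorem nablaForm_skew : nablaForm hJ X Y Z = -nablaForm hJ X Z Y := by
  have hY := mdifferentiableAt_extend_vectorField Y
  have hZ := mdifferentiableAt_extend_vectorField Z
  have hleft := mvfderiv_inner (hJ.mdifferentiableAt_apply hY) hZ X
  have hright := mvfderiv_inner hY (hJ.mdifferentiableAt_apply hZ) X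
  simp only [hJ.inner_apply_left] at hleft
  rw [← Pi.neg_def, mvfderiv_neg, neg_apply, hright, leviCivita_J hJ hY,
    leviCivita_J hJ hZ] at hleft
  simp only [extend_apply_self, inner_add_left, inner_add_right, hJ.inner_apply_left] at hleft
  rw [nablaForm, nablaForm, real_inner_comm Y]
  linarith

theorem nablaForm_J_mid : nablaForm hJ X (J x Y) Z = nablaForm hJ X Y (J x Z) := by
  simp [nablaForm, nablaJ_apply_J, hJ.inner_apply_left]

theorem nablaForm_J_J : nablaForm hJ X (J x Y) (J x Z) = -nablaForm hJ X Y Z := by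
  rw [nablaForm_J_mid, hJ.apply_apply, nablaForm, nablaForm, inner_neg_right]

theorem nablaForm_self : nablaForm hJ X Y Y = 0 := by
  linarith [nablaForm_skew hJ X Y Y]

theorem nablaForm_J_self : nablaForm hJ X Y (J x Y) = 0 := by
  linarith [nablaForm_skew hJ X Y (J x Y), nablaForm_J_mid hJ X Y Y]

/-- The symmetric tensor `S(Y, Z)` whose value `S(Y, Y) = ((∇_Y J) Y + (∇_{JY} J) JY) / 2` on the
diagonal measures how far the manifold is from being quasi-Kähler. -/
def quasiKahlerDefect : TangentSpace 𝓘(ℝ, E) x :=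
  (4⁻¹ : ℝ) • (nablaJ hJ x Z Y + nablaJ hJ x Y Z
    + (nablaJ hJ x (J x Z) (J x Y) + nablaJ hJ x (J x Y) (J x Z)))

theorem quasiKahlerDefect_self : quasiKahlerDefect hJ X X =
    (2⁻¹ : ℝ) • (nablaJ hJ x X X + nablaJ hJ x (J x X) (J x X)) := by
  rw [quasiKahlerDefect]
  module

theorem quasiKahlerDefect_comm : quasiKahlerDefect hJ Y Z = quasiKahlerDefect hJ Z Y := by
  simp only [quasiKahlerDefect]
  module

theorem quasiKahlerDefect_apply_J :
    quasiKahlerDefect hJ (J x Y) Z = -quasiKahlerDefect hJ Y (J x Z) := by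
  simp only [quasiKahlerDefect, hJ.apply_apply, map_neg, neg_apply]
  module

theorem inner_quasiKahlerDefect : (inner ℝ (quasiKahlerDefect hJ Y Z) X : ℝ) =
    1 / 4 * (nablaForm hJ Y Z X + nablaForm hJ Z Y X
      + (nablaForm hJ (J x Y) (J x Z) X + nablaForm hJ (J x Z) (J x Y) X)) := by
  simp only [quasiKahlerDefect, real_inner_smul_left, inner_add_left, nablaForm]
  ring

theorem inner_quasiKahlerDefect_self_add :
    (inner ℝ (quasiKahlerDefect hJ X X) Y + 2 * inner ℝ (quasiKahlerDefect hJ X Y) X : ℝ) = 0 := by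
  simp only [inner_quasiKahlerDefect, nablaForm_J_mid hJ _ _ X]
  linarith [nablaForm_skew hJ X X Y, nablaForm_self hJ Y X, nablaForm_J_mid hJ (J x X) X Y,
    nablaForm_skew hJ (J x X) Y (J x X), nablaForm_self hJ (J x Y) (J x X),
    nablaForm_J_mid hJ (J x Y) X X, nablaForm_J_self hJ (J x Y) X,
    nablaForm_skew hJ (J x X) X (J x Y)]

theorem inner_quasiKahlerDefect_self_J_add :
    (inner ℝ (quasiKahlerDefect hJ X X) (J x Y)
      + 2 * inner ℝ (quasiKahlerDefect hJ X Y) (J x X) : ℝ) = 0 := by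
  simp only [inner_quasiKahlerDefect]
  linarith [nablaForm_skew hJ X X (J x Y), nablaForm_J_mid hJ X Y X, nablaForm_J_self hJ Y X,
    nablaForm_self hJ (J x Y) (J x X), nablaForm_skew hJ (J x X) (J x X) (J x Y)]

theorem inner_quasiKahlerDefect_self : (inner ℝ (quasiKahlerDefect hJ X X) X : ℝ) = 0 := by
  linarith [inner_quasiKahlerDefect_self_add hJ X X]

theorem inner_quasiKahlerDefect_self_J : (inner ℝ (quasiKahlerDefect hJ X X) (J x X) : ℝ) = 0 := by
  linarith [inner_quasiKahlerDefect_self_J_add hJ X X]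

theorem inner_chernDiff_J : (inner ℝ (chernDiff hJ x Y X) (J x Z) : ℝ) =
    inner ℝ (quasiKahlerDefect hJ Y Z) X - 1 / 2 * nablaForm hJ X Y Z := by
  have hJJ := nablaForm_J_mid hJ X Y (J x Z)
  rw [inner_chernDiff, chernForm, inner_quasiKahlerDefect]
  simp only [nablaForm, inner_add_left, inner_sub_left, hJ.apply_apply, inner_neg_right, map_neg,
    neg_apply, inner_neg_left] at hJJ ⊢
  linarith

theorem inner_chernDiff_J_add_inner_chernDiff_J :
    (inner ℝ (chernDiff hJ x Y X) (J x Z) + inner ℝ (chernDiff hJ x Z X) (J x Y) : ℝ) =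
      2 * inner ℝ (quasiKahlerDefect hJ Y Z) X := by
  rw [inner_chernDiff_J, inner_chernDiff_J, quasiKahlerDefect_comm hJ Z Y]
  linarith [nablaForm_skew hJ X Y Z]

theorem inner_chernDiff_J_self : (inner ℝ (chernDiff hJ x Y X) (J x Y) : ℝ) =
    inner ℝ (quasiKahlerDefect hJ Y Y) X := by
  linarith [inner_chernDiff_J_add_inner_chernDiff_J hJ X Y Y]

theorem inner_chernDiff_skew :
    (inner ℝ (chernDiff hJ x Y X) Z : ℝ) = -inner ℝ Y (chernDiff hJ x Z X) := by
  have hmid := nablaForm_J_mid hJ X Y Z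
  have hskew := nablaForm_skew hJ X Y (J x Z)
  rw [real_inner_comm _ Y, inner_chernDiff, inner_chernDiff, chernForm, chernForm]
  simp only [nablaForm, inner_add_left, inner_sub_left] at hmid hskew ⊢
  linarith

theorem chernDiff_apply_J :
    chernDiff hJ x (J x Y) X = J x (chernDiff hJ x Y X) - nablaJ hJ x Y X := by
  refine hJ.ext_inner_J fun Z ↦ ?_
  have hJJ := inner_chernDiff_J hJ X Y (J x Z)
  have hmid := nablaForm_J_mid hJ X Y Z
  rw [hJ.apply_apply, inner_neg_right] at hJJ
  rw [inner_chernDiff_J, inner_sub_left, hJ.inner_apply, quasiKahlerDefect_apply_J, inner_neg_left]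
  simp only [nablaForm] at hJJ hmid ⊢
  linarith

end

/-! ### The difference of the bisectional curvatures -/

section

variable (hJ : IsAlmostHermitian J)

theorem contMDiffAt_quasiKahlerDefect (hY : CMDiffAt ∞ (T% Y) x) (hZ : CMDiffAt ∞ (T% Z) x) :
    CMDiffAt ∞ (T% (fun y ↦ quasiKahlerDefect hJ (Y y) (Z y))) x := by
  have hJY := hJ.contMDiffAt_apply hY
  have hJZ := hJ.contMDiffAt_apply hZ
  exact (((contMDiffAt_nablaJ hJ hY hZ).add_section (contMDiffAt_nablaJ hJ hZ hY)).add_section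
    ((contMDiffAt_nablaJ hJ hJY hJZ).add_section
      (contMDiffAt_nablaJ hJ hJZ hJY))).const_smul_section

/-- The covariant derivative of the tensor `quasiKahlerDefect` on the diagonal:
`nablaQuasiKahlerDefect hJ W x u` is `(∇_u S)(W, W)` for the tensor `S` and a vector field `W`. -/
def nablaQuasiKahlerDefect (W : Π x : M, TangentSpace 𝓘(ℝ, E) x) (x : M)
    (u : TangentSpace 𝓘(ℝ, E) x) : TangentSpace 𝓘(ℝ, E) x :=
  leviCivita (fun y ↦ quasiKahlerDefect hJ (W y) (W y)) x u
    - (2 : ℝ) • quasiKahlerDefect hJ (W x) (leviCivita W x u)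

variable {U V W : Π x : M, TangentSpace 𝓘(ℝ, E) x}

theorem inner_nablaQuasiKahlerDefect_self (hW : CMDiffAt ∞ (T% W) x)
    (u : TangentSpace 𝓘(ℝ, E) x) :
    (inner ℝ (nablaQuasiKahlerDefect hJ W x u) (W x) : ℝ) = 0 := by
  have hderiv := inner_leviCivita_add_of_orthogonal
    ((contMDiffAt_quasiKahlerDefect hJ hW hW).mdifferentiableAt (by simp))
    (hW.mdifferentiableAt (by simp)) (fun y ↦ inner_quasiKahlerDefect_self hJ (W y)) u
  rw [nablaQuasiKahlerDefect, inner_sub_left, real_inner_smul_left]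
  linarith [inner_quasiKahlerDefect_self_add hJ (W x) (leviCivita W x u)]

theorem inner_nablaQuasiKahlerDefect_J_self (hW : CMDiffAt ∞ (T% W) x)
    (u : TangentSpace 𝓘(ℝ, E) x) :
    (inner ℝ (nablaQuasiKahlerDefect hJ W x u) (J x (W x)) : ℝ) =
      -inner ℝ (quasiKahlerDefect hJ (W x) (W x)) (nablaJ hJ x (W x) u) := by
  have hderiv := inner_leviCivita_add_of_orthogonal
    ((contMDiffAt_quasiKahlerDefect hJ hW hW).mdifferentiableAt (by simp))
    ((hJ.contMDiffAt_apply hW).mdifferentiableAt (by simp))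
    (fun y ↦ inner_quasiKahlerDefect_self_J hJ (W y)) u
  rw [leviCivita_J hJ (hW.mdifferentiableAt (by simp)), inner_add_right] at hderiv
  rw [nablaQuasiKahlerDefect, inner_sub_left, real_inner_smul_left]
  linarith [inner_quasiKahlerDefect_self_J_add hJ (W x) (leviCivita W x u)]

theorem inner_leviCivita_chernDiff_J (hV : CMDiffAt ∞ (T% V) x) (hW : CMDiffAt ∞ (T% W) x)
    (u : TangentSpace 𝓘(ℝ, E) x) :
    (inner ℝ (leviCivita (fun y ↦ chernDiff hJ y (W y) (V y)) x u) (J x (W x)) : ℝ) =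
      inner ℝ (nablaQuasiKahlerDefect hJ W x u) (V x)
        + inner ℝ (quasiKahlerDefect hJ (W x) (W x)) (leviCivita V x u)
        + inner ℝ (chernDiff hJ x (leviCivita W x u) (V x)) (J x (W x))
        - inner ℝ (chernDiff hJ x (W x) (V x)) (nablaJ hJ x (W x) u) := by
  have hdiff := (contMDiffAt_chernDiff hJ hV hW).mdifferentiableAt (by simp)
  have hdefect := (contMDiffAt_quasiKahlerDefect hJ hW hW).mdifferentiableAt (by simp)
  have hVx := hV.mdifferentiableAt (by simp)
  have hWx := hW.mdifferentiableAt (by simp)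
  -- Differentiate `h(A_V W, J W) = h(S(W, W), V)`.
  have hderiv := mvfderiv_inner hdiff (hJ.mdifferentiableAt_apply hWx) u
  simp only [inner_chernDiff_J_self] at hderiv
  rw [mvfderiv_inner hdefect hVx, leviCivita_J hJ hWx, inner_add_right] at hderiv
  rw [nablaQuasiKahlerDefect, inner_sub_left, real_inner_smul_left]
  linarith [inner_chernDiff_J_add_inner_chernDiff_J hJ (V x) (W x) (leviCivita W x u)]

theorem inner_chernDiff_chernDiff_J (u v w : TangentSpace 𝓘(ℝ, E) x) :
    (inner ℝ (chernDiff hJ x (chernDiff hJ x w v) u) (J x w) : ℝ) =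
      inner ℝ (chernDiff hJ x w v) (nablaJ hJ x w u)
        - inner ℝ (chernDiff hJ x w v) (J x (chernDiff hJ x w u)) := by
  rw [inner_chernDiff_skew, chernDiff_apply_J, inner_sub_right, neg_sub]

theorem curvature_leviCivita_sub_curvature_chern (hU : CMDiffAt ∞ (T% U) x)
    (hV : CMDiffAt ∞ (T% V) x) (hW : CMDiffAt ∞ (T% W) x) :
    curvature leviCivita U V W x - curvature (chern hJ) U V W x =
      leviCivita (fun y ↦ chernDiff hJ y (W y) (V y)) x (U x)
      - leviCivita (fun y ↦ chernDiff hJ y (W y) (U y)) x (V x)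
      + chernDiff hJ x (leviCivita W x (V x)) (U x) - chernDiff hJ x (leviCivita W x (U x)) (V x)
      + chernDiff hJ x (chernDiff hJ x (W x) (V x)) (U x)
      - chernDiff hJ x (chernDiff hJ x (W x) (U x)) (V x)
      - chernDiff hJ x (W x) (leviCivita V x (U x) - leviCivita U x (V x)) := by
  have hchern (Y : Π x : M, TangentSpace 𝓘(ℝ, E) x) (y : M) (u : TangentSpace 𝓘(ℝ, E) y) :
      chern hJ Y y u = leviCivita Y y u + chernDiff hJ y (Y y) u := rfl
  have hUV := leviCivita_add ((contMDiffAt_leviCivita hV hW).mdifferentiableAt (by simp))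
    ((contMDiffAt_chernDiff hJ hV hW).mdifferentiableAt (by simp)) (U x)
  have hVU := leviCivita_add ((contMDiffAt_leviCivita hU hW).mdifferentiableAt (by simp))
    ((contMDiffAt_chernDiff hJ hU hW).mdifferentiableAt (by simp)) (V x)
  rw [leviCivita_sub_leviCivita (hU.mdifferentiableAt (by simp)) (hV.mdifferentiableAt (by simp))]
  simp only [curvature, hchern, hUV, hVU, map_add, add_apply]
  abel

theorem inner_curvature_leviCivita_sub_curvature_chern (hU : CMDiffAt ∞ (T% U) x)
    (hV : CMDiffAt ∞ (T% V) x) (hW : CMDiffAt ∞ (T% W) x) :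
    (inner ℝ (curvature leviCivita U V W x - curvature (chern hJ) U V W x) (J x (W x)) : ℝ) =
      inner ℝ (nablaQuasiKahlerDefect hJ W x (U x)) (V x)
        - inner ℝ (nablaQuasiKahlerDefect hJ W x (V x)) (U x)
        + 2 * inner ℝ (chernDiff hJ x (W x) (U x)) (J x (chernDiff hJ x (W x) (V x))) := by
  have hcomm : (inner ℝ (chernDiff hJ x (W x) (V x)) (J x (chernDiff hJ x (W x) (U x))) : ℝ) =
      -inner ℝ (chernDiff hJ x (W x) (U x)) (J x (chernDiff hJ x (W x) (V x))) := by
    rw [real_inner_comm, hJ.inner_apply_left]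
  rw [curvature_leviCivita_sub_curvature_chern hJ hU hV hW]
  simp only [inner_add_left, inner_sub_left, inner_leviCivita_chernDiff_J hJ hV hW,
    inner_leviCivita_chernDiff_J hJ hU hW, inner_chernDiff_chernDiff_J, inner_chernDiff_J_self,
    inner_sub_right, hcomm]
  ring

variable (X Y : TangentSpace 𝓘(ℝ, E) x)

theorem holomorphicBisectionalCurvature_sub_hermitianBisectionalCurvature :
    holomorphicBisectionalCurvature J x X Y - hermitianBisectionalCurvature hJ x X Y =
      inner ℝ (nablaQuasiKahlerDefect hJ (extend E Y) x X) (J x X)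
        - inner ℝ (nablaQuasiKahlerDefect hJ (extend E Y) x (J x X)) X
        + 2 * inner ℝ (chernDiff hJ x Y X) (J x (chernDiff hJ x Y (J x X))) := by
  have h := inner_curvature_leviCivita_sub_curvature_chern hJ (contMDiffAt_extend_vectorField X)
    (contMDiffAt_extend_vectorField (J x X)) (contMDiffAt_extend_vectorField Y)
  rw [inner_sub_left] at h
  simpa only [holomorphicBisectionalCurvature, hermitianBisectionalCurvature,
    bisectionalCurvature, curvatureAt, extend_apply_self] using h

theorem chernDiff_self : chernDiff hJ x X X =
    -((4⁻¹ : ℝ) • J x ((3 : ℝ) • nablaJ hJ x X X + nablaJ hJ x (J x X) (J x X))) := by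
  refine hJ.ext_inner_J fun Z ↦ ?_
  have hself := inner_quasiKahlerDefect_self_add hJ X Z
  rw [quasiKahlerDefect_self, real_inner_smul_left, inner_add_left] at hself
  rw [inner_chernDiff_J, inner_neg_left, real_inner_smul_left, hJ.inner_apply, inner_add_left,
    real_inner_smul_left, nablaForm]
  linarith

theorem chernDiff_J_self : chernDiff hJ x X (J x X) =
    (4⁻¹ : ℝ) • (nablaJ hJ x (J x X) (J x X) - nablaJ hJ x X X) := by
  refine hJ.ext_inner_J fun Z ↦ ?_
  have hself := inner_quasiKahlerDefect_self_J_add hJ X Z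
  have hmid := nablaForm_J_mid hJ (J x X) X (J x Z)
  rw [quasiKahlerDefect_self, real_inner_smul_left, inner_add_left] at hself
  rw [inner_chernDiff_J, real_inner_smul_left, inner_sub_left]
  simp only [nablaForm, hJ.apply_apply, inner_neg_right] at hmid ⊢
  linarith

theorem holomorphicSectionalCurvature_sub_hermitianSectionalCurvature :
    holomorphicBisectionalCurvature J x X X - hermitianBisectionalCurvature hJ x X X =
      -(1 / 8) * (‖nablaJ hJ x X X‖ ^ 2
        + 6 * inner ℝ (nablaJ hJ x X X) (nablaJ hJ x (J x X) (J x X))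
        + ‖nablaJ hJ x (J x X) (J x X)‖ ^ 2) := by
  have hX := contMDiffAt_extend_vectorField X
  have hself := inner_nablaQuasiKahlerDefect_self hJ hX (J x X)
  have hJself := inner_nablaQuasiKahlerDefect_J_self hJ hX X
  simp only [extend_apply_self] at hself hJself
  rw [holomorphicBisectionalCurvature_sub_hermitianBisectionalCurvature, hself, hJself,
    chernDiff_self, chernDiff_J_self, quasiKahlerDefect_self]
  simp only [map_smul, hJ.inner_apply, inner_neg_left, real_inner_smul_left, inner_add_left,
    inner_sub_right, real_inner_smul_right, real_inner_self_eq_norm_sq,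
    real_inner_comm (nablaJ hJ x X X) (nablaJ hJ x (J x X) (J x X))]
  ring

end

/-! ### Quasi-Kähler manifolds -/

/-- The quasi-Kähler condition `(∇_X J) Y + (∇_{JX} J) JY = 0`. -/
def IsQuasiKahler (hJ : IsAlmostHermitian J) : Prop :=
  ∀ (x : M) (X Y : TangentSpace 𝓘(ℝ, E) x), nablaJ hJ x Y X + nablaJ hJ x (J x Y) (J x X) = 0

namespace IsQuasiKahler

variable {hJ : IsAlmostHermitian J}

theorem of_quasiKahlerDefect_self
    (h : ∀ (x : M) (X : TangentSpace 𝓘(ℝ, E) x), quasiKahlerDefect hJ X X = 0) :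
    IsQuasiKahler hJ := by
  have hdefect (x : M) (X Y : TangentSpace 𝓘(ℝ, E) x) : quasiKahlerDefect hJ X Y = 0 := by
    have hadd := h x (X + Y)
    have hX := h x X
    have hY := h x Y
    simp only [quasiKahlerDefect, map_add, add_apply] at hadd hX hY ⊢
    linear_combination (norm := module) (2⁻¹ : ℝ) • (hadd - hX - hY)
  intro x X Y
  have hXY := hdefect x X Y
  have hJXY := congrArg (J x) (hdefect x (J x X) Y)
  simp only [quasiKahlerDefect, nablaJ_apply_J, hJ.apply_apply, map_smul, map_add, map_neg,
    neg_apply, map_zero] at hXY hJXY ⊢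
  linear_combination (norm := module) (2 : ℝ) • (hXY - hJXY)

variable (hq : IsQuasiKahler hJ) (X Y : TangentSpace 𝓘(ℝ, E) x)
include hq

theorem nablaJ_J_left : nablaJ hJ x Y (J x X) = -J x (nablaJ hJ x Y X) := by
  have h := congrArg (J x) (hq x X Y)
  simp only [nablaJ_apply_J, map_add, map_neg, hJ.apply_apply, neg_neg, map_zero] at h
  exact (neg_eq_of_add_eq_zero_right h).symm

theorem quasiKahlerDefect_eq_zero : quasiKahlerDefect hJ X Y = 0 := by
  rw [quasiKahlerDefect]
  linear_combination (norm := module) (4⁻¹ : ℝ) • (hq x X Y + hq x Y X)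

theorem chernDiff_eq : chernDiff hJ x Y X = -((2⁻¹ : ℝ) • J x (nablaJ hJ x Y X)) := by
  refine hJ.ext_inner_J fun Z ↦ ?_
  rw [inner_chernDiff_J, hq.quasiKahlerDefect_eq_zero, inner_neg_left, real_inner_smul_left,
    hJ.inner_apply, inner_zero_left, nablaForm]
  ring

theorem nablaQuasiKahlerDefect_eq_zero (W : Π x : M, TangentSpace 𝓘(ℝ, E) x)
    (u : TangentSpace 𝓘(ℝ, E) x) : nablaQuasiKahlerDefect hJ W x u = 0 := by
  simp only [nablaQuasiKahlerDefect, hq.quasiKahlerDefect_eq_zero, smul_zero, sub_zero]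
  exact congrArg (fun D ↦ D x u) leviCivita.zero

theorem holomorphicBisectionalCurvature_sub_hermitianBisectionalCurvature :
    holomorphicBisectionalCurvature J x X Y - hermitianBisectionalCurvature hJ x X Y =
      1 / 2 * ‖nablaJ hJ x Y X‖ ^ 2 := by
  rw [AlmostHermitian.holomorphicBisectionalCurvature_sub_hermitianBisectionalCurvature]
  simp only [hq.nablaQuasiKahlerDefect_eq_zero, hq.chernDiff_eq, hq.nablaJ_J_left, map_neg,
    map_smul, hJ.apply_apply, neg_neg, inner_neg_left, inner_neg_right, inner_zero_left,
    real_inner_smul_left, real_inner_smul_right, hJ.inner_apply, ← real_inner_self_eq_norm_sq]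
  ring

end IsQuasiKahler

/-! ### Kähler manifolds -/

theorem eq_zero_of_symm_of_skew {α R : Type*} [AddCommGroup R] [IsAddTorsionFree R]
    {T : α → α → α → R} (hsymm : ∀ a b c, T a b c = T b a c)
    (hskew : ∀ a b c, T a b c = -T a c b) (a b c : α) : T a b c = 0 := by
  refine self_eq_neg.1 ?_
  calc T a b c = T b a c := hsymm a b c
    _ = -T b c a := hskew b a c
    _ = -T c b a := by rw [hsymm]
    _ = T c a b := by rw [hskew, neg_neg]
    _ = T a c b := hsymm c a b
    _ = -T a b c := hskew a c b

section

variable (hJ : IsAlmostHermitian J)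

theorem nijenhuis_eq (hX : MDiffAt (T% X) x) (hY : MDiffAt (T% Y) x) :
    nijenhuis J X Y x = nablaJ hJ x (Y x) (J x (X x)) - J x (nablaJ hJ x (Y x) (X x))
      - (nablaJ hJ x (X x) (J x (Y x)) - J x (nablaJ hJ x (X x) (Y x))) := by
  have hJX := hJ.mdifferentiableAt_apply hX
  have hJY := hJ.mdifferentiableAt_apply hY
  rw [nijenhuis, ← leviCivita_sub_leviCivita hJX hJY, ← leviCivita_sub_leviCivita hJX hY,
    ← leviCivita_sub_leviCivita hX hJY, ← leviCivita_sub_leviCivita hX hY]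
  simp only [leviCivita_J hJ hX, leviCivita_J hJ hY, map_sub, map_add, hJ.apply_apply]
  abel

theorem mvfderiv_kahlerForm (hY : MDiffAt (T% Y) x) (hZ : MDiffAt (T% Z) x)
    (u : TangentSpace 𝓘(ℝ, E) x) :
    d% (kahlerForm J Y Z) x u = nablaForm hJ u (Y x) (Z x)
      + (inner ℝ (J x (leviCivita Y x u)) (Z x) - inner ℝ (J x (leviCivita Z x u)) (Y x)) := by
  have h := mvfderiv_inner (hJ.mdifferentiableAt_apply hY) hZ u
  rw [leviCivita_J hJ hY, inner_add_left, hJ.inner_apply_left (Y x),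
    real_inner_comm _ (Y x)] at h
  exact h.trans (by rw [nablaForm]; ring)

theorem dKahlerForm_eq (hX : MDiffAt (T% X) x) (hY : MDiffAt (T% Y) x) (hZ : MDiffAt (T% Z) x) :
    dKahlerForm J X Y Z x = nablaForm hJ (X x) (Y x) (Z x) + nablaForm hJ (Y x) (Z x) (X x)
      + nablaForm hJ (Z x) (X x) (Y x) := by
  simp only [dKahlerForm, mvfderiv_kahlerForm hJ hX hY, mvfderiv_kahlerForm hJ hY hZ,
    mvfderiv_kahlerForm hJ hZ hX, kahlerForm, ← leviCivita_sub_leviCivita hX hY,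
    ← leviCivita_sub_leviCivita hY hZ, ← leviCivita_sub_leviCivita hZ hX, map_sub, inner_sub_left]
  ring

end

namespace IsKahler

variable (hK : IsKahler J) (hJ : IsAlmostHermitian J) (X Y Z : TangentSpace 𝓘(ℝ, E) x)
include hK

theorem nablaForm_add_nablaForm_add_nablaForm :
    nablaForm hJ X Y Z + nablaForm hJ Y Z X + nablaForm hJ Z X Y = 0 := by
  have h := hK.dKahlerForm_eq_zero x _ _ _ (contMDiffAt_extend_vectorField X)
    (contMDiffAt_extend_vectorField Y) (contMDiffAt_extend_vectorField Z)
  simpa only [dKahlerForm_eq hJ (mdifferentiableAt_extend_vectorField X)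
    (mdifferentiableAt_extend_vectorField Y) (mdifferentiableAt_extend_vectorField Z),
    extend_apply_self] using h

theorem nablaForm_J_left : nablaForm hJ (J x X) Y Z = -nablaForm hJ X Y (J x Z) := by
  refine eq_neg_of_add_eq_zero_left (eq_zero_of_symm_of_skew
    (T := fun X Y Z ↦ nablaForm hJ (J x X) Y Z + nablaForm hJ X Y (J x Z))
    (fun X Y Z ↦ ?_) (fun X Y Z ↦ ?_) X Y Z)
  · have h := hK.nijenhuis_eq_zero x _ _ (contMDiffAt_extend_vectorField X)
      (contMDiffAt_extend_vectorField Y)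
    rw [nijenhuis_eq hJ (mdifferentiableAt_extend_vectorField X)
      (mdifferentiableAt_extend_vectorField Y), sub_eq_zero] at h
    simpa only [nablaForm, extend_apply_self, inner_sub_left, hJ.inner_apply_left,
      sub_neg_eq_add] using congrArg (fun v ↦ (inner ℝ v Z : ℝ)) h
  · linarith [nablaForm_skew hJ (J x X) Y Z, nablaForm_skew hJ X Y (J x Z),
      nablaForm_J_mid hJ X Z Y]

theorem nablaForm_eq_zero : nablaForm hJ X Y Z = 0 := by
  have hcyc := hK.nablaForm_add_nablaForm_add_nablaForm hJ X Y Z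
  have hcycJ := hK.nablaForm_add_nablaForm_add_nablaForm hJ X (J x Y) (J x Z)
  rw [nablaForm_J_J, hK.nablaForm_J_left, nablaForm_J_J, hK.nablaForm_J_left, hJ.apply_apply]
    at hcycJ
  simp only [nablaForm, inner_neg_right] at hcyc hcycJ ⊢
  linarith

end IsKahler

theorem isKahler_iff_nablaJ_eq_zero (hJ : IsAlmostHermitian J) :
    IsKahler J ↔ ∀ (x : M) (X Y : TangentSpace 𝓘(ℝ, E) x), nablaJ hJ x Y X = 0 where
  mp hK x X Y := ext_inner_right ℝ fun Z ↦ by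
    rw [inner_zero_left]
    exact hK.nablaForm_eq_zero hJ X Y Z
  mpr h :=
    { toIsAlmostHermitian := hJ
      nijenhuis_eq_zero x X Y hX hY := by
        simp [nijenhuis_eq hJ (hX.mdifferentiableAt (by simp)) (hY.mdifferentiableAt (by simp)), h]
      dKahlerForm_eq_zero x X Y Z hX hY hZ := by
        simp [dKahlerForm_eq hJ (hX.mdifferentiableAt (by simp)) (hY.mdifferentiableAt (by simp))
          (hZ.mdifferentiableAt (by simp)), nablaForm, h] }

/-! ### Equality of the bisectional curvatures -/

theorem eq_zero_of_homogeneous_of_unit {V W : Type*} [NormedAddCommGroup V] [NormedSpace ℝ V]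
    [AddCommGroup W] [Module ℝ W] {f : V → W} {n : ℕ} (hn : n ≠ 0)
    (hf : ∀ (c : ℝ) (v : V), f (c • v) = c ^ n • f v) (h : ∀ v, ‖v‖ = 1 → f v = 0) (v : V) :
    f v = 0 := by
  rcases eq_or_ne v 0 with rfl | hv
  · simpa only [smul_zero, zero_pow hn, zero_smul] using hf 0 0
  · rw [← NormedSpace.norm_smul_normalize v, hf, h _ (NormedSpace.norm_normalize hv), smul_zero]

theorem isQuasiKahler_of_sectionalCurvature_eq (hJ : IsAlmostHermitian J)
    {ε : Π x : M, TangentSpace 𝓘(ℝ, E) x → ℝ} (hε : ∀ x X, ε x X ^ 2 + 6 * ε x X + 1 ≠ 0)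
    (hGray : ∀ (x : M) (X : TangentSpace 𝓘(ℝ, E) x),
      nablaJ hJ x X X = ε x X • nablaJ hJ x (J x X) (J x X))
    (h : ∀ (x : M) (X : TangentSpace 𝓘(ℝ, E) x), ‖X‖ = 1 →
      holomorphicBisectionalCurvature J x X X = hermitianBisectionalCurvature hJ x X X) :
    IsQuasiKahler hJ := by
  refine .of_quasiKahlerDefect_self fun x X ↦ eq_zero_of_homogeneous_of_unit two_ne_zero
    (f := fun X : TangentSpace 𝓘(ℝ, E) x ↦ quasiKahlerDefect hJ X X)
    (fun c X ↦ ?_) (fun X hX ↦ ?_) X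
  · simp only [quasiKahlerDefect, map_smul, smul_apply]
    module
  have hsec := holomorphicSectionalCurvature_sub_hermitianSectionalCurvature hJ X
  rw [h x X hX, sub_self, hGray x X, norm_smul, mul_pow, Real.norm_eq_abs, sq_abs,
    real_inner_smul_left, real_inner_self_eq_norm_sq] at hsec
  have hQ : nablaJ hJ x (J x X) (J x X) = 0 := by
    have hmul : (ε x X ^ 2 + 6 * ε x X + 1) * ‖nablaJ hJ x (J x X) (J x X)‖ ^ 2 = 0 := by
      linear_combination 8 * hsec
    simpa only [mul_eq_zero, hε x X, false_or, sq_eq_zero_iff, norm_eq_zero] using hmul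
  rw [quasiKahlerDefect_self, hGray x X, hQ, smul_zero, add_zero, smul_zero]

theorem IsQuasiKahler.isKahler_of_bisectionalCurvature_eq {hJ : IsAlmostHermitian J}
    (hq : IsQuasiKahler hJ) (h : ∀ (x : M) (X Y : TangentSpace 𝓘(ℝ, E) x), ‖X‖ = 1 → ‖Y‖ = 1 →
      holomorphicBisectionalCurvature J x X Y = hermitianBisectionalCurvature hJ x X Y) :
    IsKahler J := by
  refine (isKahler_iff_nablaJ_eq_zero hJ).2 fun x X Y ↦ ?_
  refine eq_zero_of_homogeneous_of_unit one_ne_zero (f := fun Y ↦ nablaJ hJ x Y X)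
    (fun c Y ↦ by simp) (fun Y hY ↦ ?_) Y
  refine eq_zero_of_homogeneous_of_unit one_ne_zero (f := nablaJ hJ x Y)
    (fun c X ↦ by simp) (fun X hX ↦ ?_) X
  have hsub := hq.holomorphicBisectionalCurvature_sub_hermitianBisectionalCurvature X Y
  rw [h x X Y hX hY, sub_self] at hsub
  simpa using hsub.symm

theorem IsKahler.holomorphicBisectionalCurvature_eq (hK : IsKahler J) (hJ : IsAlmostHermitian J)
    (X Y : TangentSpace 𝓘(ℝ, E) x) :
    holomorphicBisectionalCurvature J x X Y = hermitianBisectionalCurvature hJ x X Y := by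
  have hnabla := (isKahler_iff_nablaJ_eq_zero hJ).1 hK
  have hq : IsQuasiKahler hJ := fun x X Y ↦ by rw [hnabla, hnabla, add_zero]
  have hsub := hq.holomorphicBisectionalCurvature_sub_hermitianBisectionalCurvature X Y
  rwa [hnabla, norm_zero, zero_pow two_ne_zero, mul_zero, sub_eq_zero] at hsub

end

end AlmostHermitian

end

open AlmostHermitian in
theorem theorem8p9_general {E : Type*} [NormedAddCommGroup E] [NormedSpace ℝ E]
    [FiniteDimensional ℝ E] {M : Type*} [TopologicalSpace M] [ChartedSpace E M]
    [IsManifold 𝓘(ℝ, E) ∞ M] [RiemannianBundle (fun x : M ↦ TangentSpace 𝓘(ℝ, E) x)]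
    [IsContMDiffRiemannianBundle 𝓘(ℝ, E) ∞ E (fun x : M ↦ TangentSpace 𝓘(ℝ, E) x)]
    (J : Π x : M, TangentSpace 𝓘(ℝ, E) x →L[ℝ] TangentSpace 𝓘(ℝ, E) x)
    (hJ : IsAlmostHermitian J)
    (ε : Π x : M, TangentSpace 𝓘(ℝ, E) x → ℝ) (hε : ∀ x X, ε x X ^ 2 + 6 * ε x X + 1 ≠ 0)
    (hGray : ∀ (x : M) (X : TangentSpace 𝓘(ℝ, E) x),
      nablaJ hJ x X X = ε x X • nablaJ hJ x (J x X) (J x X)) :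
    (∀ (x : M) (X Y : TangentSpace 𝓘(ℝ, E) x),
        (inner ℝ X X : ℝ) = 1 → (inner ℝ Y Y : ℝ) = 1 →
          holomorphicBisectionalCurvature J x X Y = hermitianBisectionalCurvature hJ x X Y) ↔
      IsKahler J := by
  refine ⟨fun h ↦ ?_, fun hK x X Y _ _ ↦ hK.holomorphicBisectionalCurvature_eq hJ X Y⟩
  simp only [real_inner_self_eq_norm_sq,
    pow_eq_one_iff_of_nonneg (norm_nonneg _) two_ne_zero] at h
  exact (isQuasiKahler_of_sectionalCurvature_eq hJ hε hGray
    fun x X hX ↦ h x X X hX hX).isKahler_of_bisectionalCurvature_eq h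

open AlmostHermitian in
theorem theorem8p9 {E : Type*} [NormedAddCommGroup E] [NormedSpace ℝ E] [FiniteDimensional ℝ E]
    {M : Type*} [TopologicalSpace M] [ChartedSpace E M] [IsManifold 𝓘(ℝ, E) ∞ M]
    [RiemannianBundle (fun x : M ↦ TangentSpace 𝓘(ℝ, E) x)]
    [IsContMDiffRiemannianBundle 𝓘(ℝ, E) ∞ E (fun x : M ↦ TangentSpace 𝓘(ℝ, E) x)]
    (J : Π x : M, TangentSpace 𝓘(ℝ, E) x →L[ℝ] TangentSpace 𝓘(ℝ, E) x)
    (hJ : IsAlmostHermitian J)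
    (ε : ℝ) (hε : ε = 1 ∨ ε = -1)
    (hGray : ∀ (x : M) (X : TangentSpace 𝓘(ℝ, E) x),
      nablaJ hJ x X X = ε • nablaJ hJ x (J x X) (J x X)) :
    (∀ (x : M) (X Y : TangentSpace 𝓘(ℝ, E) x),
        (inner ℝ X X : ℝ) = 1 → (inner ℝ Y Y : ℝ) = 1 →
          holomorphicBisectionalCurvature J x X Y = hermitianBisectionalCurvature hJ x X Y) ↔
      IsKahler J :=
  theorem8p9_general J hJ (fun _ _ ↦ ε) (by rcases hε with rfl | rfl <;> norm_num) hGray
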